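/- Let $\Theta_5$ denote the graph on $5$ vertices obtained from a cycle of length $5$ by adding one edge joining two non-consecutive vertices of the cycle. For every positive integer $n$ with $n\equiv 24 \pmod{88}$ there is a planar simple graph $G$ with exactly $n$ vertices and $$e(G)=\frac{25}{11}(n-2)$$ edges such that $G$ contains neither $K_4$ nor $\Theta_5$ as a (not necessarily induced) subgraph. -/

import Mathlib

/-- The graph `Θ₅`: the cycle `0 - 1 - 2 - 3 - 4 - 0` together with one additional edge joining
the non-consecutive vertices `0` and `2` (up to isomorphism the choice of the chord is
irrelevant). -/
def theta5 : SimpleGraph (Fin 5) := SimpleGraph.cycleGraph 5 ⊔ SimpleGraph.edge 0 2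

/-- A graph is planar if it can be drawn in the plane `ℝ × ℝ`: the vertices are distinct points
`p v`, every edge `uv` is a simple arc from `p u` to `p v` (`arc e` is its set of points), an arc
passes through no vertex other than its two ends, and two different arcs meet only in common
ends. The values of `arc` at non-edges are irrelevant. -/
def SimpleGraph.IsPlanar {V : Type*} (G : SimpleGraph V) : Prop :=
  ∃ (p : V → ℝ × ℝ) (arc : Sym2 V → Set (ℝ × ℝ)),
    Function.Injective p ∧
    (∀ u v, G.Adj u v →
      ∃ γ : _root_.Path (p u) (p v), Function.Injective γ ∧ Set.range γ = arc s(u, v)) ∧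
    (∀ e ∈ G.edgeSet, ∀ w, p w ∈ arc e → w ∈ e) ∧
    (∀ e ∈ G.edgeSet, ∀ e' ∈ G.edgeSet, e ≠ e' →
      ∀ x ∈ arc e ∩ arc e', ∃ v, v ∈ e ∧ v ∈ e' ∧ p v = x)

/-! A small plane graph with 13 vertices and 25 edges is unrolled around two of its vertices, the
hubs. Its `m`-fold cyclic cover branched over the hubs has `2 + 11m` vertices and `25m` edges, which
is the required density; `n ≡ 24 [MOD 88]` is a case of `n = 2 + 11m`.

Forbidden subgraphs are excluded in the base. A `K₄` in the cover projects to a `K₄`, the base being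
loopless. A `Θ₅` projects to a closed walk of the same shape, and `coverProj_hub_of_common_neighbor`
allows two of its vertices to coincide only if all their common neighbours in it lie over hubs; a
finite check (`baseAdjTable_no_theta5`) rules this out.

For planarity, the base is drawn with straight segments in a strip of period 14, the hubs being its
two boundary lines. Rolling up `m` periods gives a sphere, and a Möbius map sends a point off the
drawing to infinity. `stripToPlane_eq` reduces intersections in the plane to intersections in the
strip, which `baseEdge_nonCrossing` settles by integer determinants. -/

/-! ### The base graph and its finite checks -/

/-- An edge of the base graph with vertex set `Fin 13`, together with its voltage `shift` and its
drawing in the strip `0 ≤ y ≤ 18` as the segment from `tail` to `head`. -/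
structure BaseEdge where
  src : Fin 13
  dst : Fin 13
  shift : ℤ
  tail : ℤ × ℤ
  head : ℤ × ℤ

/-- The base graph: a plane graph with 13 vertices, of which `11` and `12` are the two hubs, and
25 edges, whose faces are 10 triangles, paired along common edges, and 4 pentagons. -/
def baseEdge : Fin 25 → BaseEdge := ![
  ⟨2, 7, 0, (0, 7), (-2, 10)⟩,
  ⟨7, 0, 0, (-2, 10), (-4, 11)⟩,
  ⟨0, 1, 0, (-4, 11), (-3, 13)⟩,
  ⟨1, 2, 0, (-3, 13), (0, 7)⟩,
  ⟨7, 1, 0, (-2, 10), (-3, 13)⟩,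
  ⟨4, 2, 0, (-2, 6), (0, 7)⟩,
  ⟨2, 3, 0, (0, 7), (4, 6)⟩,
  ⟨11, 3, 0, (4, 0), (4, 6)⟩,
  ⟨11, 4, 0, (-2, 0), (-2, 6)⟩,
  ⟨11, 2, 0, (0, 0), (0, 7)⟩,
  ⟨0, 8, 0, (-4, 11), (-3, 9)⟩,
  ⟨8, 4, 0, (-3, 9), (-2, 6)⟩,
  ⟨4, 5, 0, (-2, 6), (-5, 10)⟩,
  ⟨5, 0, 0, (-5, 10), (-4, 11)⟩,
  ⟨8, 5, 0, (-3, 9), (-5, 10)⟩,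
  ⟨6, 5, 0, (-6, 12), (-5, 10)⟩,
  ⟨5, 9, 0, (-5, 10), (-7, 9)⟩,
  ⟨9, 3, -1, (-7, 9), (-10, 6)⟩,
  ⟨3, 6, 1, (4, 6), (8, 12)⟩,
  ⟨6, 9, 0, (-6, 12), (-7, 9)⟩,
  ⟨12, 6, 0, (-6, 18), (-6, 12)⟩,
  ⟨12, 1, 0, (-3, 18), (-3, 13)⟩,
  ⟨1, 10, 0, (-3, 13), (-4, 14)⟩,
  ⟨10, 6, 0, (-4, 14), (-6, 12)⟩,
  ⟨12, 10, 0, (-4, 18), (-4, 14)⟩]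

/-- The positions of the base vertices in the strip. -/
def basePos : Fin 13 → ℤ × ℤ :=
  ![(-4, 11), (-3, 13), (0, 7), (4, 6), (-2, 6), (-5, 10), (-6, 12), (-2, 10), (-3, 9), (-7, 9),
    (-4, 14), (0, 0), (0, 18)]

/-- Adjacency in the base graph. -/
def BaseAdj (a b : Fin 13) : Prop :=
  ∃ e, (baseEdge e).src = a ∧ (baseEdge e).dst = b ∨ (baseEdge e).src = b ∧ (baseEdge e).dst = a

instance : DecidableRel BaseAdj := fun _ _ => inferInstanceAs (Decidable (∃ _, _))

/-- Adjacency in the base graph, computed by table lookup. -/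
def baseAdjTable (a b : Fin 13) : Bool :=
  -- Entry `a` is the bit mask of the neighbours of `a`.
  (![418, 5253, 2202, 2628, 2340, 849, 5672, 7, 49, 104, 4162, 28, 1090] a : ℕ).testBit b

theorem baseAdj_iff_table : ∀ a b, BaseAdj a b ↔ baseAdjTable a b = true := by
  decide +kernel

/-- Hubs occur only as sources, so the target of a lifted edge always remembers its sheet. -/
theorem baseEdge_dst_lt : ∀ e, ((baseEdge e).dst : ℕ) < 11 := by decide +kernel

theorem baseEdge_src_ne_dst : ∀ e, (baseEdge e).src ≠ (baseEdge e).dst := by decide +kernel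

theorem baseEdge_injective : ∀ e e', (baseEdge e).src = (baseEdge e').src →
    (baseEdge e).dst = (baseEdge e').dst → e = e' := by decide +kernel

theorem baseEdge_not_reversed : ∀ e e', (baseEdge e).src = (baseEdge e').dst →
    (baseEdge e).dst ≠ (baseEdge e').src := by decide +kernel

theorem baseEdge_incident : ∀ a, ∃ e, (baseEdge e).src = a ∨ (baseEdge e).dst = a := by
  decide +kernel

theorem baseAdjTable_no_K4 : ∀ a b, baseAdjTable a b = true → ∀ c, baseAdjTable a c = true →
    baseAdjTable b c = true → ∀ d, baseAdjTable a d = true → baseAdjTable b d = true →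
    baseAdjTable c d = true → False := by
  decide +kernel

set_option synthInstance.maxHeartbeats 200000 in
set_option synthInstance.maxSize 2000 in
/-- The base graph has no closed walk shaped like `Θ₅` in which two vertices coincide only if they
are ordinary vertices all of whose common neighbours are hubs. -/
theorem baseAdjTable_no_theta5 : ∀ a b, baseAdjTable a b = true → ∀ c, baseAdjTable b c = true →
    baseAdjTable a c = true → ∀ d, baseAdjTable c d = true → (b = d → 11 ≤ c.1) →
    ∀ e, baseAdjTable d e = true → baseAdjTable e a = true → (b = e → 11 ≤ a.1) →
    (c = e → 11 ≤ a.1 ∧ 11 ≤ d.1) → (a = d → 11 ≤ c.1 ∧ 11 ≤ e.1) → False := by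
  decide +kernel

/-! ### The branched cyclic cover -/

/-- The vertices of the `m`-fold cover of the base graph branched over the two hubs. -/
abbrev CoverVertex (m : ℕ) : Type := Fin 2 ⊕ Fin 11 × ZMod m

/-- The lift of a base vertex to a sheet. -/
def coverLift (m : ℕ) (v : Fin 13) (k : ℤ) : CoverVertex m :=
  if h : v.1 < 11 then .inr (⟨v.1, h⟩, (k : ZMod m)) else .inl ⟨v.1 - 11, by omega⟩

/-- The base vertex below a vertex of the cover. -/
def coverProj {m : ℕ} : CoverVertex m → Fin 13
  | .inl h => ⟨11 + h.1, by omega⟩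
  | .inr v => ⟨v.1.1, by omega⟩

theorem coverProj_lift {m : ℕ} (v : Fin 13) (k : ℤ) : coverProj (coverLift m v k) = v := by
  unfold coverLift
  split_ifs with h
  · rfl
  · ext; simp only [coverProj]; omega

theorem coverLift_eq_iff {m : ℕ} {v w : Fin 13} {k l : ℤ} :
    coverLift m v k = coverLift m w l ↔ v = w ∧ (v.1 < 11 → (k : ZMod m) = l) := by
  constructor
  · intro h
    have hv : v = w := by simpa only [coverProj_lift] using congrArg coverProj h
    subst hv
    refine ⟨rfl, fun hlt => ?_⟩
    simpa [coverLift, hlt] using h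
  · rintro ⟨rfl, h⟩
    unfold coverLift
    split_ifs with hlt
    · rw [h hlt]
    · rfl

theorem exists_coverLift {m : ℕ} (x : CoverVertex m) : ∃ k, coverLift m (coverProj x) k = x := by
  rcases x with h | ⟨v, i⟩
  · exact ⟨0, by simp [coverLift, coverProj]⟩
  · obtain ⟨k, rfl⟩ := ZMod.intCast_surjective i
    exact ⟨k, by simp [coverLift, coverProj]⟩

/-- The lift of a base edge starting in a given sheet. -/
def coverEdge (m : ℕ) (e : Fin 25) (k : ℤ) : Sym2 (CoverVertex m) :=
  s(coverLift m (baseEdge e).src k, coverLift m (baseEdge e).dst (k + (baseEdge e).shift))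

theorem coverEdge_eq_iff {m : ℕ} {e e' : Fin 25} {k k' : ℤ} :
    coverEdge m e k = coverEdge m e' k' ↔ e = e' ∧ (k : ZMod m) = k' := by
  constructor
  · intro h
    rw [coverEdge, coverEdge, Sym2.eq_iff] at h
    rcases h with ⟨h1, h2⟩ | ⟨h1, h2⟩
    · rw [coverLift_eq_iff] at h1 h2
      obtain rfl := baseEdge_injective e e' h1.1 h2.1
      refine ⟨rfl, ?_⟩
      simpa using h2.2 (baseEdge_dst_lt e)
    · rw [coverLift_eq_iff] at h1 h2
      exact absurd h2.1 (baseEdge_not_reversed e e' h1.1)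
  · rintro ⟨rfl, h⟩
    have h1 : coverLift m (baseEdge e).src k = coverLift m (baseEdge e).src k' :=
      coverLift_eq_iff.2 ⟨rfl, fun _ => h⟩
    have h2 : coverLift m (baseEdge e).dst (k + (baseEdge e).shift) =
        coverLift m (baseEdge e).dst (k' + (baseEdge e).shift) :=
      coverLift_eq_iff.2 ⟨rfl, fun _ => by push_cast; rw [h]⟩
    rw [coverEdge, coverEdge, h1, h2]

/-- The `m`-fold cover of the base graph branched over the two hubs. -/
def coverGraph (m : ℕ) : SimpleGraph (CoverVertex m) where
  Adj x y := ∃ e k, coverEdge m e k = s(x, y)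
  symm := ⟨fun x y ⟨e, k, h⟩ => ⟨e, k, h.trans Sym2.eq_swap⟩⟩
  loopless := ⟨fun x ⟨e, k, h⟩ => by
    have h' : s(_, _) = s(x, x) := h
    rw [Sym2.eq_iff, or_self] at h'
    exact baseEdge_src_ne_dst e (by
      simpa only [coverProj_lift] using congrArg coverProj (h'.1.trans h'.2.symm))⟩

theorem mem_edgeSet_coverGraph {m : ℕ} {s : Sym2 (CoverVertex m)} :
    s ∈ (coverGraph m).edgeSet ↔ ∃ e k, coverEdge m e k = s := by
  induction s with
  | h x y => rfl

theorem ncard_edgeSet_coverGraph (m : ℕ) : (coverGraph m).edgeSet.ncard = 25 * m := by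
  let f : Fin 25 × ZMod m → Sym2 (CoverVertex m) := fun p => coverEdge m p.1 p.2.cast
  have hf : Function.Injective f := by
    rintro ⟨e, i⟩ ⟨e', i'⟩ h
    obtain ⟨h1, h2⟩ := coverEdge_eq_iff.1 h
    simp only [ZMod.intCast_zmod_cast] at h2
    exact Prod.ext h1 h2
  have hrange : (coverGraph m).edgeSet = Set.range f := by
    ext s
    rw [mem_edgeSet_coverGraph]
    constructor
    · rintro ⟨e, k, rfl⟩
      exact ⟨(e, (k : ZMod m)), coverEdge_eq_iff.2 ⟨rfl, by simp⟩⟩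
    · rintro ⟨p, rfl⟩
      exact ⟨p.1, _, rfl⟩
  rw [hrange, ← Set.image_univ, Set.ncard_image_of_injective _ hf, Set.ncard_univ]
  simp

theorem coverGraph_adj_cases {m : ℕ} {x y : CoverVertex m} (h : (coverGraph m).Adj x y) :
    ∃ e k, x = coverLift m (baseEdge e).src k ∧
        y = coverLift m (baseEdge e).dst (k + (baseEdge e).shift) ∨
      y = coverLift m (baseEdge e).src k ∧
        x = coverLift m (baseEdge e).dst (k + (baseEdge e).shift) := by
  obtain ⟨e, k, h⟩ := h
  rw [coverEdge, Sym2.eq_iff] at h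
  exact ⟨e, k, h.imp (fun h => ⟨h.1.symm, h.2.symm⟩) fun h => ⟨h.1.symm, h.2.symm⟩⟩

theorem baseAdjTable_coverProj {m : ℕ} {x y : CoverVertex m} (h : (coverGraph m).Adj x y) :
    baseAdjTable (coverProj x) (coverProj y) = true := by
  rw [← baseAdj_iff_table]
  obtain ⟨e, k, ⟨rfl, rfl⟩ | ⟨rfl, rfl⟩⟩ := coverGraph_adj_cases h
  · exact ⟨e, .inl (by simp only [coverProj_lift, and_self])⟩
  · exact ⟨e, .inr (by simp only [coverProj_lift, and_self])⟩

/-! ### Excluding `K₄` and `Θ₅` -/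

/-- The projection to the base graph is injective on the neighbourhood of every vertex that is not
a hub. -/
theorem coverProj_hub_of_common_neighbor {m : ℕ} {w x y : CoverVertex m} (hne : x ≠ y)
    (hx : (coverGraph m).Adj w x) (hy : (coverGraph m).Adj w y)
    (h : coverProj x = coverProj y) : 11 ≤ (coverProj w).1 := by
  by_contra! hw
  apply hne
  -- Both edges lie over the same base edge, traversed in the same direction; the sheet of `w` then
  -- fixes the sheet of the other end.
  obtain ⟨e, k, ⟨h1, h2⟩ | ⟨h1, h2⟩⟩ := coverGraph_adj_cases hx <;>
  obtain ⟨e', k', ⟨h3, h4⟩ | ⟨h3, h4⟩⟩ := coverGraph_adj_cases hy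
  · subst h2 h4
    rw [h1, coverProj_lift] at hw
    rw [h1, coverLift_eq_iff] at h3
    simp only [coverProj_lift] at h
    obtain rfl := baseEdge_injective e e' h3.1 h
    refine coverLift_eq_iff.2 ⟨rfl, fun _ => ?_⟩
    push_cast
    rw [h3.2 hw]
  · subst h2 h3
    rw [h1, coverLift_eq_iff] at h4
    simp only [coverProj_lift] at h
    exact absurd h (baseEdge_not_reversed e e' h4.1)
  · subst h1 h4
    rw [h2, coverLift_eq_iff] at h3
    simp only [coverProj_lift] at h
    exact absurd h3.1 (baseEdge_not_reversed e e' h)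
  · subst h1 h3
    rw [h2, coverLift_eq_iff] at h4
    simp only [coverProj_lift] at h
    obtain rfl := baseEdge_injective e e' h h4.1
    refine coverLift_eq_iff.2 ⟨rfl, fun _ => ?_⟩
    simpa using h4.2 (baseEdge_dst_lt e)

theorem coverGraph_free_K4 (m : ℕ) : (⊤ : SimpleGraph (Fin 4)).Free (coverGraph m) := by
  rintro ⟨f⟩
  have h (i j : Fin 4) (hij : i ≠ j) :
      baseAdjTable (coverProj (f i)) (coverProj (f j)) = true :=
    baseAdjTable_coverProj (f.toHom.map_adj hij)
  exact baseAdjTable_no_K4 _ _ (h 0 1 (by decide)) _ (h 0 2 (by decide)) (h 1 2 (by decide)) _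
    (h 0 3 (by decide)) (h 1 3 (by decide)) (h 2 3 (by decide))

/-- Any two non-adjacent vertices of `Θ₅` have a common neighbour, so every possible coincidence
under the projection is controlled by hubs. -/
theorem coverGraph_free_theta5 (m : ℕ) : theta5.Free (coverGraph m) := by
  rintro ⟨f⟩
  have adj {i j : Fin 5} (hij : theta5.Adj i j) : (coverGraph m).Adj (f i) (f j) :=
    f.toHom.map_adj hij
  have ne {i j : Fin 5} (hij : i ≠ j) : f i ≠ f j := f.injective.ne hij
  have h01 : theta5.Adj 0 1 := by simp [theta5, SimpleGraph.cycleGraph_adj]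
  have h12 : theta5.Adj 1 2 := by simp [theta5, SimpleGraph.cycleGraph_adj]
  have h23 : theta5.Adj 2 3 := by simp [theta5, SimpleGraph.cycleGraph_adj]
  have h34 : theta5.Adj 3 4 := by simp [theta5, SimpleGraph.cycleGraph_adj]
  have h40 : theta5.Adj 4 0 := .inl (by rw [SimpleGraph.cycleGraph_adj]; decide)
  have h02 : theta5.Adj 0 2 := by simp [theta5, SimpleGraph.edge_adj]
  have tab {i j : Fin 5} (hij : theta5.Adj i j) := baseAdjTable_coverProj (adj hij)
  have hub {i j k : Fin 5} (hij : i ≠ j) (hi : theta5.Adj k i) (hj : theta5.Adj k j)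
      (h : coverProj (f i) = coverProj (f j)) : 11 ≤ (coverProj (f k)).1 :=
    coverProj_hub_of_common_neighbor (ne hij) (adj hi) (adj hj) h
  exact baseAdjTable_no_theta5 _ _ (tab h01) _ (tab h12) (tab h02) _ (tab h23)
    (hub (by decide) h12.symm h23) _ (tab h34) (tab h40) (hub (by decide) h01 h40.symm)
    (fun h => ⟨hub (by decide) h02 h40.symm h, hub (by decide) h23.symm h34 h⟩)
    (fun h => ⟨hub (by decide) h02.symm h23 h, hub (by decide) h40 h34.symm h⟩)

/-! ### Intersections of integer segments -/

/-- The determinant of the vectors `B - A` and `C - A`. -/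
def orientation (A B C : ℤ × ℤ) : ℤ :=
  (B.1 - A.1) * (C.2 - A.2) - (B.2 - A.2) * (C.1 - A.1)

/-- A certificate for the segments `AB` and `CD` to meet at most in a common end: one of them lies
strictly on one side of the line through the other, or they are not parallel and share an end. -/
def NonCrossing (A B C D : ℤ × ℤ) : Prop :=
  0 < orientation A B C * orientation A B D ∨ 0 < orientation C D A * orientation C D B ∨
    (A = C ∨ A = D ∨ B = C ∨ B = D) ∧
      (B.1 - A.1) * (D.2 - C.2) - (B.2 - A.2) * (D.1 - C.1) ≠ 0

instance (A B C D : ℤ × ℤ) : Decidable (NonCrossing A B C D) :=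
  inferInstanceAs (Decidable (_ ∨ _))

/-- Orientation relative to a line is affine along a segment, so it cannot vanish between two ends
on the same side. -/
theorem convex_combination_ne_zero {a b : ℤ} (h : 0 < a * b) {s : ℝ} (h0 : 0 ≤ s) (h1 : s ≤ 1) :
    (1 - s) * a + s * b ≠ 0 := by
  have hR : (0 : ℝ) < a * b := by exact_mod_cast h
  rcases pos_and_pos_or_neg_and_neg_of_mul_pos hR with ⟨ha, hb⟩ | ⟨ha, hb⟩
  · have h2 := mul_nonneg (sub_nonneg.2 h1) ha.le
    have h3 := mul_nonneg h0 hb.le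
    intro h
    have h4 : s * (b : ℝ) = 0 := by linarith
    have h5 : (1 - s) * (a : ℝ) = 0 := by linarith
    have h6 := (mul_eq_zero.1 h4).resolve_right hb.ne'
    have h7 := (mul_eq_zero.1 h5).resolve_right ha.ne'
    linarith
  · have h2 := mul_nonneg (sub_nonneg.2 h1) (neg_nonneg.2 ha.le)
    have h3 := mul_nonneg h0 (neg_nonneg.2 hb.le)
    intro h
    have h4 : s * (b : ℝ) = 0 := by linarith
    have h5 : (1 - s) * (a : ℝ) = 0 := by linarith
    have h6 := (mul_eq_zero.1 h4).resolve_right hb.ne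
    have h7 := (mul_eq_zero.1 h5).resolve_right ha.ne
    linarith

theorem eq_zero_of_mul_eq_mul {a b c d t s : ℝ} (hdet : a * d - b * c ≠ 0)
    (h1 : t * a = s * c) (h2 : t * b = s * d) : t = 0 ∧ s = 0 := by
  constructor
  · refine (mul_eq_zero.1 ?_).resolve_right hdet
    linear_combination d * h1 - c * h2
  · refine (mul_eq_zero.1 ?_).resolve_right hdet
    linear_combination b * h1 - a * h2

theorem NonCrossing.endpoints {A B C D : ℤ × ℤ} (h : NonCrossing A B C D) {t s : ℝ}
    (ht : t ∈ Set.Icc (0 : ℝ) 1) (hs : s ∈ Set.Icc (0 : ℝ) 1)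
    (hx : A.1 + t * (B.1 - A.1) = C.1 + s * (D.1 - C.1))
    (hy : A.2 + t * (B.2 - A.2) = C.2 + s * (D.2 - C.2)) :
    (t = 0 ∨ t = 1) ∧ (s = 0 ∨ s = 1) := by
  rcases h with h | h | ⟨hshare, hdet⟩
  · refine absurd ?_ (convex_combination_ne_zero h hs.1 hs.2)
    simp only [orientation]
    push_cast
    linear_combination (B.2 - A.2 : ℝ) * hx - (B.1 - A.1 : ℝ) * hy
  · refine absurd ?_ (convex_combination_ne_zero h ht.1 ht.2)
    simp only [orientation]
    push_cast
    linear_combination (D.1 - C.1 : ℝ) * hy - (D.2 - C.2 : ℝ) * hx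
  · have hdet' : ((B.1 : ℝ) - A.1) * (D.2 - C.2) - (B.2 - A.2) * (D.1 - C.1) ≠ 0 := by
      exact_mod_cast hdet
    rcases hshare with rfl | rfl | rfl | rfl
    · obtain ⟨h1, h2⟩ := eq_zero_of_mul_eq_mul (t := t) (s := s) hdet'
        (by linear_combination hx) (by linear_combination hy)
      exact ⟨.inl h1, .inl h2⟩
    · obtain ⟨h1, h2⟩ := eq_zero_of_mul_eq_mul (t := t) (s := s - 1) hdet'
        (by linear_combination hx) (by linear_combination hy)
      exact ⟨.inl h1, .inr (by linarith)⟩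
    · obtain ⟨h1, h2⟩ := eq_zero_of_mul_eq_mul (t := t - 1) (s := s) hdet'
        (by linear_combination hx) (by linear_combination hy)
      exact ⟨.inr (by linarith), .inl h2⟩
    · obtain ⟨h1, h2⟩ := eq_zero_of_mul_eq_mul (t := t - 1) (s := s - 1) hdet'
        (by linear_combination hx) (by linear_combination hy)
      exact ⟨.inr (by linarith), .inr (by linarith)⟩

/-! ### Finite checks on the drawing in the strip -/

/-- Three translates suffice: all abscissae lie in `[-10, 8]`, so translates by 28 or more cannot
meet. -/
theorem baseEdge_nonCrossing : ∀ e e', ∀ d : Fin 3, (e = e' ∧ d = 1) ∨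
    NonCrossing (baseEdge e).tail (baseEdge e).head
      ((baseEdge e').tail.1 + 14 * ((d : ℤ) - 1), (baseEdge e').tail.2)
      ((baseEdge e').head.1 + 14 * ((d : ℤ) - 1), (baseEdge e').head.2) := by
  decide +kernel

theorem baseEdge_bounds : ∀ e, -10 ≤ (baseEdge e).tail.1 ∧ (baseEdge e).tail.1 ≤ 8 ∧
    -10 ≤ (baseEdge e).head.1 ∧ (baseEdge e).head.1 ≤ 8 ∧
    0 ≤ (baseEdge e).tail.2 ∧ (baseEdge e).tail.2 ≤ 18 ∧
    0 < (baseEdge e).head.2 ∧ (baseEdge e).head.2 < 18 ∧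
    (baseEdge e).tail.2 ≠ (baseEdge e).head.2 := by
  decide +kernel

theorem baseEdge_avoids_pole : ∀ e, (baseEdge e).tail.2 < 9 ∧ (baseEdge e).head.2 < 9 ∨
    9 < (baseEdge e).tail.2 ∧ 9 < (baseEdge e).head.2 ∨
    orientation (baseEdge e).tail (baseEdge e).head (0, 9) ≠ 0 := by
  decide +kernel

theorem baseEdge_tail : ∀ e, (baseEdge e).tail.2 = (basePos (baseEdge e).src).2 ∧
    ((baseEdge e).tail.1 = (basePos (baseEdge e).src).1 ∨
      (baseEdge e).tail.2 = 0 ∨ (baseEdge e).tail.2 = 18) := by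
  decide +kernel

theorem baseEdge_head : ∀ e, (baseEdge e).head.2 = (basePos (baseEdge e).dst).2 ∧
    (baseEdge e).head.1 = (basePos (baseEdge e).dst).1 + 14 * (baseEdge e).shift := by
  decide +kernel

theorem basePos_snd : ∀ v : Fin 13, 0 ≤ (basePos v).2 ∧ (basePos v).2 ≤ 18 ∧
    (v.1 < 11 → 0 < (basePos v).2 ∧ (basePos v).2 < 18) ∧
    (11 ≤ v.1 → (basePos v).2 = 0 ∨ (basePos v).2 = 18) := by
  decide +kernel

theorem basePos_avoids_pole : ∀ v, (basePos v).2 = 9 → (basePos v).1 % 14 ≠ 0 := by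
  decide +kernel

/-- A hub is a whole collapsed line, so its ordinate alone must identify it. -/
theorem basePos_injective : ∀ v w, (basePos v).2 = (basePos w).2 →
    (11 ≤ v.1 ∨ ((basePos v).1 - (basePos w).1) % 14 = 0) → v = w := by
  decide +kernel

/-! ### Rolling the strip up -/

/-- The unit complex number of argument `2πx / (14m)`. -/
noncomputable def cylinderAngle (m : ℕ) (x : ℝ) : ℂ :=
  Complex.exp ((2 * Real.pi * x / (14 * m) : ℝ) * Complex.I)

/-- The map from the strip `0 ≤ y ≤ 18` to the plane that is periodic with period `14m` in `x` and
collapses each of the lines `y = 0` and `y = 18`: it rolls the strip up to a sphere, from which the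
point `x = 0, y = 9` is sent to infinity. -/
noncomputable def stripToPlane (m : ℕ) (x y : ℝ) : ℂ :=
  -- This is `w / (w - 1)` for `w = y * cylinderAngle m x / (18 - y)`, with denominators cleared so
  -- that `y = 18` is allowed.
  y * cylinderAngle m x / (y * cylinderAngle m x - (18 - y))

/-- The point `(x, y)` lies in the strip and is not sent to infinity. -/
def StripRegular (m : ℕ) (x y : ℝ) : Prop :=
  0 ≤ y ∧ y ≤ 18 ∧ (y = 9 → ∀ d : ℤ, x ≠ 14 * (m * d))

theorem norm_cylinderAngle (m : ℕ) (x : ℝ) : ‖cylinderAngle m x‖ = 1 :=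
  Complex.norm_exp_ofReal_mul_I _

theorem cylinderAngle_eq_iff {m : ℕ} (hm : m ≠ 0) {x x' : ℝ} :
    cylinderAngle m x = cylinderAngle m x' ↔ ∃ d : ℤ, x = x' + 14 * (m * d) := by
  rw [cylinderAngle, cylinderAngle, Complex.exp_eq_exp_iff_exists_int]
  refine exists_congr fun d => ?_
  have hm' : (m : ℝ) ≠ 0 := Nat.cast_ne_zero.2 hm
  have hpi := Real.pi_ne_zero
  have h1 : ((2 * Real.pi * x' / (14 * m) : ℝ) * Complex.I + d * (2 * Real.pi * Complex.I)) =
      ((2 * Real.pi * (x' + 14 * (m * d)) / (14 * m) : ℝ) : ℂ) * Complex.I := by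
    have h2 : 2 * Real.pi * (x' + 14 * (m * d)) / (14 * m) =
        2 * Real.pi * x' / (14 * m) + d * (2 * Real.pi) := by
      field_simp
    rw [h2]
    push_cast
    ring
  rw [h1, mul_left_inj' Complex.I_ne_zero, Complex.ofReal_inj]
  constructor
  · intro h
    field_simp at h
    linarith
  · rintro rfl
    rfl

theorem stripToPlane_congr {m : ℕ} (hm : m ≠ 0) {x x' y : ℝ}
    (h : y = 0 ∨ y = 18 ∨ ∃ d : ℤ, x = x' + 14 * (m * d)) :
    stripToPlane m x y = stripToPlane m x' y := by
  have h1 (x : ℝ) : cylinderAngle m x ≠ 0 := Complex.exp_ne_zero _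
  rcases h with rfl | rfl | h
  · simp [stripToPlane]
  · simp [stripToPlane, h1]
  · rw [stripToPlane, stripToPlane, (cylinderAngle_eq_iff hm).2 h]

theorem StripRegular.denom_ne_zero {m : ℕ} (hm : m ≠ 0) {x y : ℝ} (h : StripRegular m x y) :
    (y * cylinderAngle m x - (18 - y) : ℂ) ≠ 0 := by
  obtain ⟨h0, h18, h9⟩ := h
  intro h
  have h' : (y * cylinderAngle m x : ℂ) = ((18 - y : ℝ) : ℂ) := by
    push_cast
    linear_combination h
  have hn := congrArg norm h'
  rw [norm_mul, norm_cylinderAngle, mul_one, Complex.norm_of_nonneg h0,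
    Complex.norm_of_nonneg (by linarith)] at hn
  obtain rfl : y = 9 := by linarith
  have h1 : cylinderAngle m x = cylinderAngle m 0 := by
    have h2 : cylinderAngle m 0 = 1 := by simp [cylinderAngle]
    rw [h2]
    push_cast at h'
    linear_combination h' / 9
  obtain ⟨d, hd⟩ := (cylinderAngle_eq_iff hm).1 h1
  exact h9 rfl d (by linarith)

/-- Cross-multiplying leaves `y (18 - y') u = y' (18 - y) u'` with `u`, `u'` of norm one; norms give
the ordinates, and cancellation then gives the angles. -/
theorem stripToPlane_eq {m : ℕ} (hm : m ≠ 0) {x y x' y' : ℝ} (h : StripRegular m x y)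
    (h' : StripRegular m x' y') (heq : stripToPlane m x y = stripToPlane m x' y') :
    y = y' ∧ (0 < y → y < 18 → ∃ d : ℤ, x = x' + 14 * (m * d)) := by
  rw [stripToPlane, stripToPlane, div_eq_div_iff (h.denom_ne_zero hm) (h'.denom_ne_zero hm)] at heq
  have h1 : ((y * (18 - y') : ℝ) : ℂ) * cylinderAngle m x =
      ((y' * (18 - y) : ℝ) : ℂ) * cylinderAngle m x' := by
    push_cast
    linear_combination -heq
  have hn := congrArg norm h1
  rw [norm_mul, norm_mul, norm_cylinderAngle, norm_cylinderAngle, mul_one, mul_one,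
    Complex.norm_of_nonneg (mul_nonneg h.1 (sub_nonneg.2 h'.2.1)),
    Complex.norm_of_nonneg (mul_nonneg h'.1 (sub_nonneg.2 h.2.1))] at hn
  obtain rfl : y = y' := by linarith
  refine ⟨rfl, fun hpos hlt => (cylinderAngle_eq_iff hm).1 (mul_left_cancel₀ ?_ h1)⟩
  exact Complex.ofReal_ne_zero.2 (mul_pos hpos (sub_pos.2 hlt)).ne'

/-! ### Drawing the cover -/

/-- The abscissa of the point with parameter `t` on the segment of a base edge. -/
noncomputable def segX (e : Fin 25) (t : ℝ) : ℝ :=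
  (baseEdge e).tail.1 + t * ((baseEdge e).head.1 - (baseEdge e).tail.1)

/-- The ordinate of the point with parameter `t` on the segment of a base edge. -/
noncomputable def segY (e : Fin 25) (t : ℝ) : ℝ :=
  (baseEdge e).tail.2 + t * ((baseEdge e).head.2 - (baseEdge e).tail.2)

theorem segX_mem (e : Fin 25) {t : ℝ} (ht : t ∈ Set.Icc (0 : ℝ) 1) :
    segX e t ∈ Set.Icc (-10 : ℝ) 8 := by
  obtain ⟨h1, h2, h3, h4, -⟩ := baseEdge_bounds e
  have h1 : (-10 : ℝ) ≤ (baseEdge e).tail.1 := by exact_mod_cast h1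
  have h2 : ((baseEdge e).tail.1 : ℝ) ≤ 8 := by exact_mod_cast h2
  have h3 : (-10 : ℝ) ≤ (baseEdge e).head.1 := by exact_mod_cast h3
  have h4 : ((baseEdge e).head.1 : ℝ) ≤ 8 := by exact_mod_cast h4
  have ht' := sub_nonneg.2 ht.2
  constructor <;> unfold segX
  · nlinarith [mul_nonneg ht.1 (sub_nonneg.2 h3), mul_nonneg ht' (sub_nonneg.2 h1)]
  · nlinarith [mul_nonneg ht.1 (sub_nonneg.2 h4), mul_nonneg ht' (sub_nonneg.2 h2)]

theorem segY_mem (e : Fin 25) {t : ℝ} (ht : t ∈ Set.Icc (0 : ℝ) 1) :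
    segY e t ∈ Set.Icc (0 : ℝ) 18 ∧ (segY e t = 0 ∨ segY e t = 18 → t = 0) := by
  obtain ⟨-, -, -, -, h1, h2, h3, h4, -⟩ := baseEdge_bounds e
  have h1 : (0 : ℝ) ≤ (baseEdge e).tail.2 := by exact_mod_cast h1
  have h2 : ((baseEdge e).tail.2 : ℝ) ≤ 18 := by exact_mod_cast h2
  have h3 : (0 : ℝ) < (baseEdge e).head.2 := by exact_mod_cast h3
  have h4 : ((baseEdge e).head.2 : ℝ) < 18 := by exact_mod_cast h4
  have ht' := sub_nonneg.2 ht.2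
  have h5 := mul_nonneg ht' h1
  have h6 := mul_nonneg ht' (sub_nonneg.2 h2)
  have h7 := mul_nonneg ht.1 h3.le
  have h8 := mul_nonneg ht.1 (sub_nonneg.2 h4.le)
  unfold segY
  refine ⟨⟨by nlinarith, by nlinarith⟩, ?_⟩
  rintro (h | h)
  · exact (mul_eq_zero.1 (by linarith : t * ((baseEdge e).head.2 : ℝ) = 0)).resolve_right h3.ne'
  · exact (mul_eq_zero.1 (by linarith : t * (18 - (baseEdge e).head.2 : ℝ) = 0)).resolve_right
      (sub_pos.2 h4).ne'

theorem segY_injective (e : Fin 25) : Function.Injective (segY e) := by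
  intro t t' h
  obtain ⟨-, -, -, -, -, -, -, -, hne⟩ := baseEdge_bounds e
  have hne : ((baseEdge e).head.2 : ℝ) - (baseEdge e).tail.2 ≠ 0 :=
    sub_ne_zero.2 (by exact_mod_cast hne.symm)
  unfold segY at h
  exact mul_right_cancel₀ hne (by linarith)

/-- The drawing of the lift of a base edge starting in sheet `k`. -/
noncomputable def coverCurve (m : ℕ) (e : Fin 25) (k : ℤ) (t : ℝ) : ℂ :=
  stripToPlane m (segX e t + 14 * k) (segY e t)

theorem seg_regular (m : ℕ) (e : Fin 25) (k : ℤ) {t : ℝ} (ht : t ∈ Set.Icc (0 : ℝ) 1) :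
    StripRegular m (segX e t + 14 * k) (segY e t) := by
  refine ⟨(segY_mem e ht).1.1, (segY_mem e ht).1.2, fun h9 d hd => ?_⟩
  have ht' := sub_nonneg.2 ht.2
  have hX : segX e t = 14 * ((m * d - k : ℤ) : ℝ) := by
    push_cast
    linarith
  have hb := segX_mem e ht
  have h0 : segX e t = 0 := by
    -- The only multiple of 14 in `[-10, 8]` is 0, so only the pole `(0, 9)` itself has to be
    -- avoided.
    rw [hX] at hb ⊢
    have h1 : (-10 : ℤ) ≤ 14 * (m * d - k) := by exact_mod_cast hb.1
    have h2 : 14 * ((m : ℤ) * d - k) ≤ 8 := by exact_mod_cast hb.2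
    have h3 : (m : ℤ) * d - k = 0 := by omega
    rw [h3]
    simp
  unfold segX at h0
  unfold segY at h9
  rcases baseEdge_avoids_pole e with ⟨h1, h2⟩ | ⟨h1, h2⟩ | h
  · have h1 : ((baseEdge e).tail.2 : ℝ) < 9 := by exact_mod_cast h1
    have h2 : ((baseEdge e).head.2 : ℝ) < 9 := by exact_mod_cast h2
    nlinarith [mul_nonneg ht' (sub_nonneg.2 h1.le), mul_nonneg ht.1 (sub_nonneg.2 h2.le)]
  · have h1 : (9 : ℝ) < (baseEdge e).tail.2 := by exact_mod_cast h1
    have h2 : (9 : ℝ) < (baseEdge e).head.2 := by exact_mod_cast h2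
    nlinarith [mul_nonneg ht' (sub_nonneg.2 h1.le), mul_nonneg ht.1 (sub_nonneg.2 h2.le)]
  · apply h
    have hR : ((orientation (baseEdge e).tail (baseEdge e).head (0, 9) : ℤ) : ℝ) = 0 := by
      simp only [orientation]
      push_cast
      linear_combination ((baseEdge e).head.2 - (baseEdge e).tail.2 : ℝ) * h0 -
        ((baseEdge e).head.1 - (baseEdge e).tail.1 : ℝ) * h9
    exact_mod_cast hR

/-- The drawings of two edges meet at most in ends of both. -/
theorem coverCurve_eq {m : ℕ} (hm : m ≠ 0) {e e' : Fin 25} {k k' : ℤ} {t t' : ℝ}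
    (ht : t ∈ Set.Icc (0 : ℝ) 1) (ht' : t' ∈ Set.Icc (0 : ℝ) 1)
    (h : coverCurve m e k t = coverCurve m e' k' t') :
    coverEdge m e k = coverEdge m e' k' ∨ (t = 0 ∨ t = 1) ∧ (t' = 0 ∨ t' = 1) := by
  obtain ⟨hY, hX⟩ := stripToPlane_eq hm (seg_regular m e k ht) (seg_regular m e' k' ht') h
  -- Segments reach the collapsed boundary lines only at their tails.
  by_cases h0 : segY e t = 0 ∨ segY e t = 18
  · exact .inr ⟨.inl ((segY_mem e ht).2 h0), .inl ((segY_mem e' ht').2 (hY ▸ h0))⟩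
  push Not at h0
  obtain ⟨d, hd⟩ := hX ((segY_mem e ht).1.1.lt_of_ne' h0.1) ((segY_mem e ht).1.2.lt_of_ne h0.2)
  obtain ⟨D, hD⟩ : ∃ D : ℤ, D = k' + m * d - k := ⟨_, rfl⟩
  have hXD : segX e t = segX e' t' + 14 * (D : ℝ) := by
    rw [hD]
    push_cast
    linarith
  have hb := segX_mem e ht
  have hb' := segX_mem e' ht'
  have h1 : 14 * D ≤ 18 := by
    have h2 : 14 * (D : ℝ) ≤ 18 := by linarith [hb.2, hb'.1]
    exact_mod_cast h2
  have h2 : -18 ≤ 14 * D := by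
    have h2 : -18 ≤ 14 * (D : ℝ) := by linarith [hb.1, hb'.2]
    exact_mod_cast h2
  obtain ⟨i, rfl⟩ : ∃ i : Fin 3, D = (i : ℤ) - 1 :=
    ⟨⟨(D + 1).toNat, by omega⟩, by simp only; omega⟩
  rcases baseEdge_nonCrossing e e' i with ⟨rfl, rfl⟩ | hnc
  · left
    refine coverEdge_eq_iff.2 ⟨rfl, ?_⟩
    have hk : k = k' + m * d := by simp at hD; omega
    rw [hk]
    simp
  · right
    refine hnc.endpoints ht ht' ?_ ?_
    · unfold segX at hXD
      push_cast at hXD ⊢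
      linarith
    · exact hY

/-- No base segment is horizontal, so the ordinate determines the parameter. -/
theorem coverCurve_injOn {m : ℕ} (hm : m ≠ 0) (e : Fin 25) (k : ℤ) :
    Set.InjOn (coverCurve m e k) (Set.Icc 0 1) := fun _ ht _ ht' h =>
  segY_injective e (stripToPlane_eq hm (seg_regular m e k ht) (seg_regular m e k ht') h).1

theorem coverCurve_congr {m : ℕ} (hm : m ≠ 0) {e e' : Fin 25} {k k' : ℤ}
    (h : coverEdge m e k = coverEdge m e' k') (t : ℝ) :
    coverCurve m e k t = coverCurve m e' k' t := by
  obtain ⟨rfl, hk⟩ := coverEdge_eq_iff.1 h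
  obtain ⟨d, hd⟩ := (ZMod.intCast_eq_intCast_iff_dvd_sub k' k m).1 hk.symm
  refine stripToPlane_congr hm (.inr (.inr ⟨d, ?_⟩))
  have hk : (k : ℝ) - k' = m * d := by exact_mod_cast hd
  linear_combination 14 * hk

theorem continuous_coverCurve {m : ℕ} (hm : m ≠ 0) (e : Fin 25) (k : ℤ) :
    Continuous fun t : unitInterval => coverCurve m e k t := by
  unfold coverCurve stripToPlane
  refine Continuous.div ?_ ?_ fun t => (seg_regular m e k t.2).denom_ne_zero hm
  all_goals
    unfold cylinderAngle segX segY
    fun_prop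

/-- The sheet of a vertex of the cover; hubs are put in sheet `0`. -/
def coverSheet {m : ℕ} : CoverVertex m → ℤ
  | .inl _ => 0
  | .inr v => v.2.cast

/-- The position of a vertex of the cover in the plane. -/
noncomputable def coverPos {m : ℕ} (x : CoverVertex m) : ℂ :=
  stripToPlane m ((basePos (coverProj x)).1 + 14 * coverSheet x) (basePos (coverProj x)).2

theorem coverPos_lift {m : ℕ} (hm : m ≠ 0) (v : Fin 13) (k : ℤ) :
    coverPos (coverLift m v k) = stripToPlane m ((basePos v).1 + 14 * k) (basePos v).2 := by
  rw [coverPos, coverProj_lift]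
  apply stripToPlane_congr hm
  by_cases hv : v.1 < 11
  · right; right
    have h : ((coverSheet (coverLift m v k) : ℤ) : ZMod m) = k := by
      simp [coverLift, hv, coverSheet]
    obtain ⟨d, hd⟩ := (ZMod.intCast_eq_intCast_iff_dvd_sub _ _ m).1 h.symm
    refine ⟨d, ?_⟩
    have hk : (coverSheet (coverLift m v k) : ℝ) - k = m * d := by exact_mod_cast hd
    linear_combination 14 * hk
  · rw [← or_assoc]
    left
    exact_mod_cast (basePos_snd v).2.2.2 (not_lt.1 hv)

theorem basePos_regular (m : ℕ) (v : Fin 13) (k : ℤ) :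
    StripRegular m ((basePos v).1 + 14 * k) (basePos v).2 := by
  refine ⟨by exact_mod_cast (basePos_snd v).1, by exact_mod_cast (basePos_snd v).2.1,
    fun h9 d hd => ?_⟩
  have h1 : (basePos v).1 + 14 * k = 14 * (m * d) := by exact_mod_cast hd
  exact basePos_avoids_pole v (by exact_mod_cast h9) (by omega)

theorem coverPos_injective {m : ℕ} (hm : m ≠ 0) :
    Function.Injective (coverPos : CoverVertex m → ℂ) := by
  intro x y h
  obtain ⟨k, hk⟩ := exists_coverLift x
  obtain ⟨l, hl⟩ := exists_coverLift y
  generalize coverProj x = v at hk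
  generalize coverProj y = w at hl
  subst hk hl
  rw [coverPos_lift hm, coverPos_lift hm] at h
  obtain ⟨hY, hX⟩ := stripToPlane_eq hm (basePos_regular m v k) (basePos_regular m w l) h
  have hY' : (basePos v).2 = (basePos w).2 := by exact_mod_cast hY
  rw [coverLift_eq_iff]
  by_cases hv : v.1 < 11
  · obtain ⟨h0, h18⟩ := (basePos_snd v).2.2.1 hv
    obtain ⟨d, hd⟩ := hX (by exact_mod_cast h0) (by exact_mod_cast h18)
    have hd' : (basePos v).1 + 14 * k = (basePos w).1 + 14 * l + 14 * (m * d) := by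
      exact_mod_cast hd
    obtain rfl := basePos_injective v w hY' (.inr (by omega))
    refine ⟨rfl, fun _ => ?_⟩
    have hk : k = l + m * d := by omega
    rw [hk]
    simp
  · exact ⟨basePos_injective v w hY' (.inl (not_lt.1 hv)), fun h => absurd h hv⟩

theorem coverCurve_zero {m : ℕ} (hm : m ≠ 0) (e : Fin 25) (k : ℤ) :
    coverCurve m e k 0 = coverPos (coverLift m (baseEdge e).src k) := by
  obtain ⟨hY, hX⟩ := baseEdge_tail e
  rw [coverPos_lift hm, coverCurve, segX, segY, ← hY, zero_mul, zero_mul, add_zero, add_zero]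
  refine stripToPlane_congr hm ?_
  rcases hX with h | h | h
  · exact .inr (.inr ⟨0, by rw [h]; simp⟩)
  · exact .inl (by exact_mod_cast h)
  · exact .inr (.inl (by exact_mod_cast h))

theorem coverCurve_one {m : ℕ} (hm : m ≠ 0) (e : Fin 25) (k : ℤ) :
    coverCurve m e k 1 =
      coverPos (coverLift m (baseEdge e).dst (k + (baseEdge e).shift)) := by
  obtain ⟨hY, hX⟩ := baseEdge_head e
  rw [coverPos_lift hm, coverCurve, segX, segY, ← hY, one_mul, one_mul, add_sub_cancel,
    add_sub_cancel, hX]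
  push_cast
  congr 1
  ring

theorem coverCurve_endpoint {m : ℕ} (hm : m ≠ 0) (e : Fin 25) (k : ℤ) {t : ℝ}
    (ht : t = 0 ∨ t = 1) : ∃ v ∈ coverEdge m e k, coverPos v = coverCurve m e k t := by
  rcases ht with rfl | rfl
  · exact ⟨_, Sym2.mem_mk_left _ _, (coverCurve_zero hm e k).symm⟩
  · exact ⟨_, Sym2.mem_mk_right _ _, (coverCurve_one hm e k).symm⟩

/-- Since every vertex is an end of some edge, a vertex lying on an arc becomes a case of two arcs
meeting. -/
theorem exists_coverCurve_eq_coverPos {m : ℕ} (hm : m ≠ 0) (x : CoverVertex m) :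
    ∃ e k, x ∈ coverEdge m e k ∧ ∃ t ∈ Set.Icc (0 : ℝ) 1, coverCurve m e k t = coverPos x := by
  obtain ⟨k, hk⟩ := exists_coverLift x
  obtain ⟨e, h | h⟩ := baseEdge_incident (coverProj x)
  · rw [← h] at hk
    subst hk
    exact ⟨e, k, Sym2.mem_mk_left _ _, 0, by simp, coverCurve_zero hm e k⟩
  · rw [← h, ← sub_add_cancel k (baseEdge e).shift] at hk
    subst hk
    exact ⟨e, _, Sym2.mem_mk_right _ _, 1, by simp, coverCurve_one hm e _⟩

theorem coverGraph_isPlanar {m : ℕ} (hm : m ≠ 0) : (coverGraph m).IsPlanar := by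
  let ι := Complex.equivRealProdCLM
  let arc : Sym2 (CoverVertex m) → Set (ℝ × ℝ) := fun s =>
    {z | ∃ e k, coverEdge m e k = s ∧ ∃ t ∈ Set.Icc (0 : ℝ) 1, ι (coverCurve m e k t) = z}
  refine ⟨fun x => ι (coverPos x), arc, ι.injective.comp (coverPos_injective hm), ?_, ?_, ?_⟩
  · have path (e : Fin 25) (k : ℤ) :
        ∃ γ : _root_.Path (ι (coverPos (coverLift m (baseEdge e).src k)))
          (ι (coverPos (coverLift m (baseEdge e).dst (k + (baseEdge e).shift)))),
          Function.Injective γ ∧ Set.range γ = arc (coverEdge m e k) := by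
      refine ⟨⟨⟨fun t => ι (coverCurve m e k t),
        ι.continuous.comp (continuous_coverCurve hm e k)⟩, ?_, ?_⟩, ?_, ?_⟩
      · simp [coverCurve_zero hm]
      · simp [coverCurve_one hm]
      · intro t t' h
        exact Subtype.ext (coverCurve_injOn hm e k t.2 t'.2 (ι.injective h))
      · ext z
        constructor
        · rintro ⟨t, rfl⟩
          exact ⟨e, k, rfl, t, t.2, rfl⟩
        · rintro ⟨e', k', h, t, ht, rfl⟩
          exact ⟨⟨t, ht⟩, congrArg ι (coverCurve_congr hm h.symm t)⟩
    intro u v huv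
    obtain ⟨e, k, h⟩ := huv
    obtain ⟨γ, hγ, hrange⟩ := path e k
    rw [← h]
    rw [coverEdge, Sym2.eq_iff] at h
    rcases h with ⟨rfl, rfl⟩ | ⟨rfl, rfl⟩
    · exact ⟨γ, hγ, hrange⟩
    · refine ⟨γ.symm, hγ.comp unitInterval.symm_bijective.injective, ?_⟩
      rw [Path.symm_range, hrange]
  · rintro s - w ⟨e, k, rfl, t, ht, hw⟩
    obtain ⟨e', k', hmem, t', ht', hw'⟩ := exists_coverCurve_eq_coverPos hm w
    have hcurve := ι.injective hw
    rcases coverCurve_eq hm ht ht' (hcurve.trans hw'.symm) with h | ⟨h, -⟩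
    · rwa [h]
    · obtain ⟨v, hv, hpos⟩ := coverCurve_endpoint hm e k h
      rwa [← coverPos_injective hm (hpos.trans hcurve)]
  · rintro s - s' - hne z ⟨⟨e, k, rfl, t, ht, rfl⟩, ⟨e', k', rfl, t', ht', hz⟩⟩
    have hcurve := ι.injective hz
    obtain ⟨h, h'⟩ := (coverCurve_eq hm ht ht' hcurve.symm).resolve_left hne
    obtain ⟨v, hv, hpos⟩ := coverCurve_endpoint hm e k h
    obtain ⟨v', hv', hpos'⟩ := coverCurve_endpoint hm e' k' h'
    obtain rfl := coverPos_injective hm (hpos.trans (hcurve.symm.trans hpos'.symm))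
    exact ⟨v, hv, hv', congrArg ι hpos⟩

/-! ### Transfer to `Fin n` and conclusion -/

theorem SimpleGraph.IsPlanar.of_iso {V W : Type*} {G : SimpleGraph V} {H : SimpleGraph W}
    (f : G ≃g H) (h : H.IsPlanar) : G.IsPlanar := by
  obtain ⟨p, arc, hp, hpath, hvertex, hcross⟩ := h
  have hmem {e : Sym2 V} (he : e ∈ G.edgeSet) : e.map f ∈ H.edgeSet := f.map_mem_edgeSet_iff.2 he
  have hends {v : V} {e : Sym2 V} : f v ∈ e.map f ↔ v ∈ e := by
    simp [Sym2.mem_map]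
  refine ⟨p ∘ f, arc ∘ Sym2.map f, hp.comp f.injective,
    fun u v huv => hpath _ _ (f.map_adj_iff.2 huv),
    fun e he w hw => hends.1 (hvertex _ (hmem he) _ hw), fun e he e' he' hne x hx => ?_⟩
  obtain ⟨v, hv, hv', hx⟩ := hcross _ (hmem he) _ (hmem he')
    ((Sym2.map.injective f.injective).ne hne) x hx
  obtain ⟨u, rfl⟩ := f.surjective v
  exact ⟨u, hends.1 hv, hends.1 hv', hx⟩

theorem lemma3p1 (n : ℕ) (hn : n ≡ 24 [MOD 88]) :
    ∃ G : SimpleGraph (Fin n),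
      G.IsPlanar ∧
      (⊤ : SimpleGraph (Fin 4)).Free G ∧
      theta5.Free G ∧
      (G.edgeSet.ncard : ℚ) = 25 / 11 * ((n : ℚ) - 2) := by
  obtain ⟨m, hm, rfl⟩ : ∃ m, m ≠ 0 ∧ n = 2 + 11 * m := by
    have h : n % 88 = 24 := hn
    -- `88q + 24 = 2 + 11(8q + 2)`.
    exact ⟨8 * (n / 88) + 2, by omega, by omega⟩
  have : NeZero m := ⟨hm⟩
  let φ : Fin (2 + 11 * m) ≃ CoverVertex m :=
    Fintype.equivOfCardEq (by simp [ZMod.card])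
  let f : (coverGraph m).comap φ ≃g coverGraph m := SimpleGraph.Iso.comap φ _
  refine ⟨(coverGraph m).comap φ, (coverGraph_isPlanar hm).of_iso f,
    (SimpleGraph.free_congr_right f).2 (coverGraph_free_K4 m),
    (SimpleGraph.free_congr_right f).2 (coverGraph_free_theta5 m), ?_⟩
  have hcard : ((coverGraph m).comap φ).edgeSet.ncard = 25 * m := by
    rw [← ncard_edgeSet_coverGraph m]
    exact Nat.card_congr f.mapEdgeSet
  rw [hcard]
  push_cast
  ring
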